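/- Let $d$ be a dimension, let $G(t,x)=(2\pi t)^{-d/2}e^{-|x|^2/(2t)}$ for $t>0$, $x\in\mathbb{R}^d$, and let $\kappa\in\mathbb{R}$. Consider continuous functions $f:\mathbb{R}\to\mathbb{R}$ such that \[ f(u_2)-f(u_1)\le \kappa(u_2-u_1)\quad\text{whenever } u_1<u_2, \] and such that, for some $K>0$ and $\nu\ge 0$, $|f(u)|\le Ke^{K|u|^\nu}$ for all $u\in\mathbb{R}$. For $T>0$ and $z\in C_b([0,T]\times\mathbb{R}^d)$ (bounded and continuous), a function $u:[0,T]\times\mathbb{R}^d\to\mathbb{R}$ is called a solution with data $z$ if for every $(t,x)\in[0,T]\times\mathbb{R}^d$ the function $(s,y)\mapsto G(t-s,x-y)f(u(s,y))$ is Lebesgue integrable on $(0,t)\times\mathbb{R}^d$ and \[ u(t,x)=\int_0^t\int_{\mathbb{R}^d}G(t-s,x-y)f(u(s,y))\,dy\,ds+z(t,x). \] \textbf{Theorem (Lipschitz continuity of the solution map $\mathcal{M}:z\mapsto u$).} For every $\theta>0$ there is a constant $C>0$, depending only on $\theta$, $\kappa$ and the dimension $d$, such that for every $f$ as above, every $T>0$,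 all $z_1,z_2\in C_b([0,T]\times\mathbb{R}^d)$, all solutions $u_1$ with data $z_1$ and $u_2$ with data $z_2$, and every $x_0\in\mathbb{R}^d$, \[ \sup_{t\in[0,T]}\sup_{x\in\mathbb{R}^d}\frac{|u_1(t,x)-u_2(t,x)|}{1+|x-x_0|^\theta}\le Ce^{CT}\sup_{t\in[0,T]}\sup_{x\in\mathbb{R}^d}\frac{|z_1(t,x)-z_2(t,x)|}{1+|x-x_0|^\theta}. \] In particular, $C$ does not depend on $x_0$ or $T$. Moreover, for each $f$, $T$ and $z\in C_b([0,T]\times\mathbb{R}^d)$ there is at most one solution with data $z$ on $[0,T]\times\mathbb{R}^d$. -/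

import Mathlib

open Set MeasureTheory

/-- Euclidean space `ℝ^d`. -/
abbrev Space (d : ℕ) : Type := EuclideanSpace ℝ (Fin d)

/-- The heat kernel `G(t,x) = (2πt)^(-d/2) exp(-|x|²/(2t))` of `∂ₜ - ½Δ` on `ℝ^d`
(only its values at times `t > 0` matter). -/
noncomputable def heatKernel {d : ℕ} (t : ℝ) (x : Space d) : ℝ :=
  (2 * Real.pi * t) ^ (-(d : ℝ) / 2) * Real.exp (-‖x‖ ^ 2 / (2 * t))

/-- `f` is continuous and `f u₂ - f u₁ ≤ κ (u₂ - u₁)` whenever `u₁ < u₂`, and `|f|` grows at most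
like `K exp (K |u| ^ ν)` for some `K > 0` and `ν ≥ 0`. -/
structure IsDrift (κ : ℝ) (f : ℝ → ℝ) : Prop where
  continuous : Continuous f
  oneSidedLipschitz : ∀ u₁ u₂ : ℝ, u₁ < u₂ → f u₂ - f u₁ ≤ κ * (u₂ - u₁)
  growth : ∃ K ν : ℝ, 0 < K ∧ 0 ≤ ν ∧ ∀ u : ℝ, |f u| ≤ K * Real.exp (K * |u| ^ ν)

/-- The restriction of `z` to `[0,T] × ℝ^d` belongs to `C_b([0,T] × ℝ^d)`. Functions of `(t,x)` are
total here, but only their values on `[0,T] × ℝ^d` are used. -/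
def IsBoundedContinuous {d : ℕ} (T : ℝ) (z : ℝ → Space d → ℝ) : Prop :=
  ContinuousOn (fun p : ℝ × Space d => z p.1 p.2) (Icc 0 T ×ˢ univ) ∧
    ∃ B : ℝ, ∀ t ∈ Icc 0 T, ∀ x : Space d, |z t x| ≤ B

/-- `u` solves `u(t,x) = ∫₀ᵗ ∫ G(t-s,x-y) f(u(s,y)) dy ds + z(t,x)` at every point of
`[0,T] × ℝ^d`, where the space-time integral converges absolutely. Nothing else is required of `u`:
neither boundedness nor continuity. -/
def IsSolution {d : ℕ} (f : ℝ → ℝ) (T : ℝ) (z u : ℝ → Space d → ℝ) : Prop :=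
  ∀ t ∈ Icc 0 T, ∀ x : Space d,
    IntegrableOn (fun p : ℝ × Space d => heatKernel (t - p.1) (x - p.2) * f (u p.1 p.2))
      (Ioo 0 t ×ˢ univ) ∧
    u t x = (∫ s in (0 : ℝ)..t, ∫ y, heatKernel (t - s) (x - y) * f (u s y)) + z t x

/-- `sup_{t ∈ [0,T]} sup_{x ∈ ℝ^d} |ψ(t,x)| / (1 + |x - x₀|^θ)`, a supremum in `[0,∞]`. -/
noncomputable def weightedNorm {d : ℕ} (T θ : ℝ) (x₀ : Space d) (ψ : ℝ → Space d → ℝ) : ENNReal :=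
  ⨆ t ∈ Icc 0 T, ⨆ x : Space d, ENNReal.ofReal (|ψ t x| / (1 + ‖x - x₀‖ ^ θ))

/-! Write `F = f(u₁) - f(u₂)` and `ζ = z₁ - z₂`. Then `u₁ - u₂ = a - b + ζ`, where `a`, `b` are the
heat potentials of the positive and negative parts of `F`. Let `S ≥ |ζ|` be a supersolution of `∂ₜ -
½Δ - 2κ⁺`. Where `a - b ≥ S`, one has `0 ≤ u₁ - u₂ ≤ a - b + S`, so the one-sided Lipschitz bound
gives `F ≤ κ⁺((a - b - S) + 2S)`. A maximum principle should then yield `a - b ≤ S` everywhere, and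
exchanging the two solutions gives the estimate.

Solutions have no regularity, so nothing is differentiated. Let `R_β`, convolution with
`resolventKernel d β`, be the causal inverse of `∂ₜ - ½Δ + β`; the resolvent equation `resolvent_eq`
replaces the differential equation. In `heatPotential_le_of_supersolution` it gives, for `k = (a - b
- S)⁺` and every `n`, `k ≤ (n + κ) R_n k + R_n e_n`, where `e_n` is the source left over on `{a < b
+ S}`. A Gronwall iteration, `eq_zero_of_le_lconvolution`, turns this into `k ≤ R_{-κ} e_n`, which
tends to `0`.

The supersolution is `barrier`, comparable with `1 + |x - x₀|^θ` up to constants and an exponential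
in time. Working in `[0,∞]` makes truncated subtraction a positive part and leaves finiteness as the
only integrability question. -/

open scoped ENNReal

/-! ### The heat kernel: mass one and Chapman–Kolmogorov. -/

lemma heatKernel_nonneg {d : ℕ} {t : ℝ} (ht : 0 < t) (x : Space d) : 0 ≤ heatKernel t x := by
  unfold heatKernel; positivity

lemma heatKernel_pos {d : ℕ} {t : ℝ} (ht : 0 < t) (x : Space d) : 0 < heatKernel t x := by
  unfold heatKernel; positivity

lemma heatKernel_neg {d : ℕ} (t : ℝ) (x : Space d) : heatKernel t (-x) = heatKernel t x := by
  simp [heatKernel]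

@[fun_prop]
lemma measurable_heatKernel {d : ℕ} {α : Type*} [MeasurableSpace α] {f : α → ℝ} {g : α → Space d}
    (hf : Measurable f) (hg : Measurable g) : Measurable fun a => heatKernel (f a) (g a) := by
  unfold heatKernel; fun_prop

lemma lintegral_heatKernel {d : ℕ} {t : ℝ} (ht : 0 < t) :
    ∫⁻ x : Space d, ENNReal.ofReal (heatKernel t x) = 1 := by
  have h1 : ∫ x : Space d, heatKernel t x = 1 := by
    have h := GaussianFourier.integral_rexp_neg_mul_sq_norm (V := Space d) (b := 1 / (2 * t))
      (by positivity)
    have h2 : ∀ x : Space d, heatKernel t x = (2 * Real.pi * t) ^ (-(d : ℝ) / 2) *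
        Real.exp (-(1 / (2 * t)) * ‖x‖ ^ 2) := fun x => by
      unfold heatKernel; congr 2; ring
    simp_rw [h2]
    rw [integral_const_mul, h, finrank_euclideanSpace_fin,
      show Real.pi / (1 / (2 * t)) = 2 * Real.pi * t by field_simp,
      ← Real.rpow_add (by positivity)]
    simp [neg_div]
  rw [← ofReal_integral_eq_lintegral_ofReal, h1, ENNReal.ofReal_one]
  · exact .of_integral_ne_zero (by rw [h1]; exact one_ne_zero)
  · exact .of_forall fun x => heatKernel_nonneg ht x

/-- Completing the square in `y` produces the Brownian bridge density, a Gaussian of variance `s t /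
(s + t)`; integrating it out gives the semigroup property. -/
lemma heatKernel_mul_heatKernel {d : ℕ} {s t : ℝ} (hs : 0 < s) (ht : 0 < t) (x y : Space d) :
    heatKernel s y * heatKernel t (-y + x) =
      heatKernel (s + t) x * heatKernel (s * t / (s + t)) (y - (s / (s + t)) • x) := by
  unfold heatKernel
  rw [mul_mul_mul_comm, mul_mul_mul_comm (_ ^ (_ : ℝ)) (Real.exp (-‖x‖ ^ 2 / (2 * (s + t)))),
    ← Real.mul_rpow (by positivity) (by positivity),
    ← Real.mul_rpow (by positivity) (by positivity), ← Real.exp_add, ← Real.exp_add]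
  congr 2
  · field_simp
  · rw [neg_add_eq_sub, norm_sub_sq_real, norm_sub_sq_real, norm_smul, inner_smul_right,
      real_inner_comm x y, Real.norm_of_nonneg (by positivity)]
    field_simp
    ring

lemma lintegral_heatKernel_mul_heatKernel {d : ℕ} {s t : ℝ} (hs : 0 < s) (ht : 0 < t)
    (x : Space d) :
    ∫⁻ y : Space d, ENNReal.ofReal (heatKernel s y) * ENNReal.ofReal (heatKernel t (-y + x)) =
      ENNReal.ofReal (heatKernel (s + t) x) := by
  simp_rw [← ENNReal.ofReal_mul (heatKernel_nonneg hs _), heatKernel_mul_heatKernel hs ht,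
    ENNReal.ofReal_mul (heatKernel_nonneg (add_pos hs ht) _)]
  rw [lintegral_const_mul _ (by fun_prop),
    lintegral_sub_right_eq_self (μ := volume)
      (fun y : Space d => ENNReal.ofReal (heatKernel (s * t / (s + t)) y)),
    lintegral_heatKernel (by positivity), mul_one]

/-! ### Resolvent kernels and the resolvent equation. -/

/-- The space-time kernel `e^(-βt) G(t,x)` on `t > 0`, extended by zero. -/
noncomputable def resolventKernel (d : ℕ) (β : ℝ) : ℝ × Space d → ℝ≥0∞ :=
  (Ioi 0 ×ˢ univ).indicator fun p => ENNReal.ofReal (Real.exp (-β * p.1) * heatKernel p.1 p.2)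

@[fun_prop]
lemma measurable_resolventKernel (d : ℕ) (β : ℝ) : Measurable (resolventKernel d β) :=
  Measurable.indicator (by fun_prop) (measurableSet_Ioi.prod .univ)

lemma resolventKernel_of_pos {d : ℕ} (β : ℝ) {t : ℝ} (ht : 0 < t) (x : Space d) :
    resolventKernel d β (t, x) =
      ENNReal.ofReal (Real.exp (-β * t)) * ENNReal.ofReal (heatKernel t x) := by
  rw [resolventKernel, indicator_of_mem (by simpa using ht), ENNReal.ofReal_mul (by positivity)]

lemma resolventKernel_of_nonpos {d : ℕ} (β : ℝ) {p : ℝ × Space d} (hp : p.1 ≤ 0) :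
    resolventKernel d β p = 0 :=
  indicator_of_notMem (by simpa using hp) _

lemma resolventKernel_anti {d : ℕ} {α β : ℝ} (h : β ≤ α) (p : ℝ × Space d) :
    resolventKernel d α p ≤ resolventKernel d β p := by
  obtain ⟨t, x⟩ := p
  rcases le_or_gt t 0 with ht | ht
  · rw [resolventKernel_of_nonpos _ ht]; exact zero_le
  · rw [resolventKernel_of_pos _ ht, resolventKernel_of_pos _ ht]
    gcongr

lemma lintegral_exp_mul_exp {α β t : ℝ} (h : β ≤ α) (ht : 0 < t) :
    ENNReal.ofReal (α - β) * ∫⁻ r in Ioo 0 t,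
      ENNReal.ofReal (Real.exp (-α * r) * Real.exp (-β * (t - r))) =
      ENNReal.ofReal (Real.exp (-β * t) - Real.exp (-α * t)) := by
  have hd : ∀ r : ℝ, HasDerivAt (fun r => -Real.exp (-α * r + -β * (t - r)))
      ((α - β) * (Real.exp (-α * r) * Real.exp (-β * (t - r)))) r := fun r => by
    have h1 : HasDerivAt (fun r => -α * r + -β * (t - r)) (-α + β) r := by
      have := ((hasDerivAt_id r).const_mul (-α)).add
        (((hasDerivAt_id r).const_sub t).const_mul (-β))
      exact this.congr_deriv (by ring)
    exact h1.exp.neg.congr_deriv (by rw [Real.exp_add]; ring)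
  have hi := intervalIntegral.integral_eq_sub_of_hasDerivAt (a := 0) (b := t)
    (fun r _ => hd r) (Continuous.intervalIntegrable (by fun_prop) _ _)
  rw [← lintegral_const_mul _ (by fun_prop)]
  simp_rw [← ENNReal.ofReal_mul (sub_nonneg.2 h)]
  rw [← ofReal_integral_eq_lintegral_ofReal, ← integral_Ioc_eq_integral_Ioo,
    ← intervalIntegral.integral_of_le ht.le, hi]
  · congr 1; simp; ring
  · exact (Continuous.integrableOn_Icc (by fun_prop)).mono_set Ioo_subset_Icc_self
  · exact .of_forall fun r => mul_nonneg (sub_nonneg.2 h) (by positivity)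

/-- The resolvent equation, for the kernels. -/
lemma resolventKernel_eq {d : ℕ} {α β : ℝ} (h : β ≤ α) :
    resolventKernel d β = resolventKernel d α +
      ENNReal.ofReal (α - β) • (resolventKernel d α ⋆ₗ resolventKernel d β) := by
  ext ⟨t, x⟩
  simp only [Pi.add_apply, Pi.smul_apply, smul_eq_mul, lconvolution_def]
  rcases le_or_gt t 0 with ht | ht
  · rw [resolventKernel_of_nonpos _ ht, resolventKernel_of_nonpos _ ht]
    rw [lintegral_eq_zero_of_ae_eq_zero, mul_zero, add_zero]
    refine .of_forall fun q => ?_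
    rcases le_or_gt q.1 0 with hq | hq
    · simp [resolventKernel_of_nonpos _ hq]
    · have : (-q + (t, x)).1 ≤ 0 := by simp; linarith
      simp [resolventKernel_of_nonpos _ this]
  -- At a fixed intermediate time, the space integral is Chapman–Kolmogorov; what remains is an
  -- elementary integral of exponentials over `0 < r < t`.
  have key : ∀ r : ℝ, ∫⁻ y : Space d, resolventKernel d α (r, y) *
      resolventKernel d β (-(r, y) + (t, x)) = (Ioo 0 t).indicator (fun r =>
        ENNReal.ofReal (Real.exp (-α * r) * Real.exp (-β * (t - r)))) r *
          ENNReal.ofReal (heatKernel t x) := by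
    intro r
    by_cases hr : r ∈ Ioo 0 t
    · rw [indicator_of_mem hr]
      have h1 : ∀ y : Space d, resolventKernel d α (r, y) *
          resolventKernel d β (-(r, y) + (t, x)) =
          ENNReal.ofReal (Real.exp (-α * r) * Real.exp (-β * (t - r))) *
            (ENNReal.ofReal (heatKernel r y) *
              ENNReal.ofReal (heatKernel (t - r) (-y + x))) := fun y => by
        rw [Prod.neg_mk, Prod.mk_add_mk, neg_add_eq_sub r t, resolventKernel_of_pos _ hr.1,
          resolventKernel_of_pos _ (sub_pos.2 hr.2), mul_mul_mul_comm,
          ENNReal.ofReal_mul (by positivity)]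
      simp_rw [h1]
      rw [lintegral_const_mul _ (by fun_prop),
        lintegral_heatKernel_mul_heatKernel hr.1 (sub_pos.2 hr.2), add_sub_cancel]
    · rw [indicator_of_notMem hr, zero_mul]
      refine lintegral_eq_zero_of_ae_eq_zero (.of_forall fun y => ?_)
      rcases le_or_gt r 0 with hq | hq
      · simp [resolventKernel_of_nonpos α (p := (r, y)) hq]
      · have : -r + t ≤ 0 := by
          have : t ≤ r := not_lt.1 fun h => hr ⟨hq, h⟩
          linarith
        simp [resolventKernel_of_nonpos β (p := (-r + t, -y + x)) this]
  rw [Measure.volume_eq_prod, lintegral_prod _ (by fun_prop)]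
  simp_rw [key]
  rw [lintegral_mul_const _ (Measurable.indicator (by fun_prop) measurableSet_Ioo),
    lintegral_indicator measurableSet_Ioo, ← mul_assoc, lintegral_exp_mul_exp h ht,
    resolventKernel_of_pos _ ht, resolventKernel_of_pos _ ht, ← add_mul,
    ← ENNReal.ofReal_add (by positivity)]
  · congr 2; ring
  · rw [sub_nonneg, Real.exp_le_exp]; nlinarith

/-! ### Linearity of convolution with values in `[0,∞]`. -/

section Convolution

variable {G : Type*} [MeasurableSpace G] [AddCommGroup G] [MeasurableAdd₂ G] [MeasurableNeg G]
  {μ : Measure G}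

lemma lconvolution_add_right {f g h : G → ℝ≥0∞} (hf : Measurable f) (hg : Measurable g) :
    f ⋆ₗ[μ] (g + h) = f ⋆ₗ[μ] g + f ⋆ₗ[μ] h := by
  ext x
  simp only [lconvolution_def, Pi.add_apply, mul_add]
  exact lintegral_add_left (by fun_prop) _

lemma lconvolution_add_left {f g h : G → ℝ≥0∞} (hf : Measurable f) (hh : Measurable h) :
    (f + g) ⋆ₗ[μ] h = f ⋆ₗ[μ] h + g ⋆ₗ[μ] h := by
  ext x
  simp only [lconvolution_def, Pi.add_apply, add_mul]
  exact lintegral_add_left (by fun_prop) _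

lemma lconvolution_smul_right {f g : G → ℝ≥0∞} (c : ℝ≥0∞) (hf : Measurable f)
    (hg : Measurable g) : f ⋆ₗ[μ] (c • g) = c • (f ⋆ₗ[μ] g) := by
  ext x
  simp only [lconvolution_def, Pi.smul_apply, smul_eq_mul, mul_left_comm _ c]
  exact lintegral_const_mul _ (by fun_prop)

lemma lconvolution_smul_left {f g : G → ℝ≥0∞} (c : ℝ≥0∞) (hf : Measurable f)
    (hg : Measurable g) : (c • f) ⋆ₗ[μ] g = c • (f ⋆ₗ[μ] g) := by
  ext x
  simp only [lconvolution_def, Pi.smul_apply, smul_eq_mul, mul_assoc]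
  exact lintegral_const_mul _ (by fun_prop)

end Convolution

/-! ### Resolvents acting on space-time sources, and a Gronwall lemma. -/

variable {d : ℕ}

instance : (volume : Measure (ℝ × Space d)).IsAddLeftInvariant :=
  inferInstanceAs ((volume : Measure ℝ).prod (volume : Measure (Space d))).IsAddLeftInvariant

instance : (volume : Measure (ℝ × Space d)).IsNegInvariant where
  neg_eq_self := ((Measure.measurePreserving_neg (volume : Measure ℝ)).prod
    (Measure.measurePreserving_neg (volume : Measure (Space d)))).map_eq

/-- The resolvent equation. -/
lemma resolvent_eq {α β : ℝ} (h : β ≤ α) {F : ℝ × Space d → ℝ≥0∞} (hF : Measurable F) :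
    resolventKernel d β ⋆ₗ F = resolventKernel d α ⋆ₗ F +
      ENNReal.ofReal (α - β) • (resolventKernel d α ⋆ₗ (resolventKernel d β ⋆ₗ F)) := by
  conv_lhs => rw [resolventKernel_eq h]
  rw [lconvolution_add_left (by fun_prop) hF, lconvolution_smul_left _ (by fun_prop) hF,
    lconvolution_assoc (by fun_prop) (by fun_prop) hF]

/-- Causality: the kernel lives on positive time lags, so values up to time `T` see the source only
before `T`. -/
lemma lconvolution_resolventKernel_mono {β T : ℝ} {F F' : ℝ × Space d → ℝ≥0∞}
    (h : ∀ᵐ q, q.1 < T → F q ≤ F' q) {p : ℝ × Space d} (hp : p.1 ≤ T) :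
    (resolventKernel d β ⋆ₗ F) p ≤ (resolventKernel d β ⋆ₗ F') p := by
  have hm : MeasurePreserving (fun y : ℝ × Space d => -y + p) := by
    simpa only [neg_add_eq_sub] using Measure.measurePreserving_sub_left volume p
  refine lintegral_mono_ae ?_
  filter_upwards [hm.quasiMeasurePreserving.ae h] with y hy
  rcases le_or_gt y.1 0 with h0 | h0
  · simp [resolventKernel_of_nonpos _ h0]
  · gcongr
    exact hy (by simp; linarith)

lemma lconvolution_resolventKernel_anti {α β : ℝ} (h : β ≤ α) (F : ℝ × Space d → ℝ≥0∞)
    (p : ℝ × Space d) : (resolventKernel d α ⋆ₗ F) p ≤ (resolventKernel d β ⋆ₗ F) p :=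
  lintegral_mono fun _ => mul_le_mul_left (resolventKernel_anti h _) _

/-- For sources supported in positive times, all resolvents are comparable on bounded times. -/
lemma lconvolution_resolventKernel_lt_top {β : ℝ} (hβ : 0 ≤ β) {F : ℝ × Space d → ℝ≥0∞}
    (hF : Measurable F) (hF0 : ∀ q, q.1 ≤ 0 → F q = 0) {p : ℝ × Space d}
    (h : (resolventKernel d 0 ⋆ₗ F) p < ∞) : (resolventKernel d (-β) ⋆ₗ F) p < ∞ := by
  refine lt_of_le_of_lt ?_ (ENNReal.mul_lt_top
    (ENNReal.ofReal_lt_top (r := Real.exp (β * p.1))) h)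
  rw [lconvolution_def, lconvolution_def, ← lintegral_const_mul _ (by fun_prop)]
  refine lintegral_mono fun q => ?_
  obtain ⟨t, x⟩ := q
  rcases le_or_gt t 0 with ht | ht
  · simp [resolventKernel_of_nonpos (-β) (p := (t, x)) ht]
  rcases le_or_gt (-(t, x) + p).1 0 with h0 | h0
  · rw [hF0 _ h0, mul_zero]; exact zero_le
  rw [resolventKernel_of_pos _ ht, resolventKernel_of_pos _ ht, ← mul_assoc]
  have : t ≤ p.1 := by simp at h0; linarith
  rw [neg_neg, neg_zero, zero_mul, Real.exp_zero, ENNReal.ofReal_one, one_mul]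
  gcongr

/-- Gronwall in resolvent form. On functions `R_{-2c} F`, the operator `c R_α` contracts by a factor
`1/2`, so iterating `hD` from the bound `hDF` leaves nothing. -/
lemma eq_zero_of_le_lconvolution {α c T : ℝ} (hα : 0 ≤ α) (hc : 0 < c)
    {D F : ℝ × Space d → ℝ≥0∞} (hF : Measurable F)
    (hF0 : ∀ q, q.1 ≤ 0 → F q = 0)
    (hfin : ∀ p, p.1 ≤ T → (resolventKernel d 0 ⋆ₗ F) p < ∞)
    (hDF : ∀ p, p.1 ≤ T → D p ≤ (resolventKernel d 0 ⋆ₗ F) p)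
    (hD : ∀ p, p.1 ≤ T → D p ≤ ENNReal.ofReal c * (resolventKernel d α ⋆ₗ D) p)
    {p : ℝ × Space d} (hp : p.1 ≤ T) : D p = 0 := by
  have key : ∀ n : ℕ, ∀ p : ℝ × Space d, p.1 ≤ T →
      D p ≤ 2⁻¹ ^ n * (resolventKernel d (-(2 * c)) ⋆ₗ F) p := by
    intro n
    induction n with
    | zero =>
      intro p hp
      rw [pow_zero, one_mul]
      exact (hDF p hp).trans (lconvolution_resolventKernel_anti (by linarith) _ _)
    | succ n ih =>
      intro p hp
      have h1 : (resolventKernel d α ⋆ₗ D) p ≤ 2⁻¹ ^ n *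
          (resolventKernel d α ⋆ₗ (resolventKernel d (-(2 * c)) ⋆ₗ F)) p := by
        rw [← smul_eq_mul, ← Pi.smul_apply, ← lconvolution_smul_right _ (by fun_prop) (by fun_prop)]
        exact lconvolution_resolventKernel_mono (.of_forall fun q hq => ih q hq.le) hp
      have h3 : 2 * ENNReal.ofReal c = ENNReal.ofReal (2 * c) := by
        rw [ENNReal.ofReal_mul (by norm_num), ENNReal.ofReal_ofNat]
      have h2 : 2 * (ENNReal.ofReal c *
          (resolventKernel d α ⋆ₗ (resolventKernel d (-(2 * c)) ⋆ₗ F)) p) ≤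
          (resolventKernel d (-(2 * c)) ⋆ₗ F) p := by
        -- The resolvent equation gives `(α + 2c) R_α R_{-2c} F ≤ R_{-2c} F`, and `2c ≤ α + 2c`.
        rw [resolvent_eq (α := α) (β := -(2 * c)) (by linarith) hF]
        refine le_trans ?_ le_add_self
        rw [← mul_assoc, Pi.smul_apply, smul_eq_mul,
          ← resolvent_eq (α := α) (β := -(2 * c)) (by linarith) hF,
          h3]
        gcongr
        linarith
      calc D p ≤ ENNReal.ofReal c * (2⁻¹ ^ n *
            (resolventKernel d α ⋆ₗ (resolventKernel d (-(2 * c)) ⋆ₗ F)) p) := by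
            refine (hD p hp).trans ?_
            gcongr
        _ = 2⁻¹ ^ n * (2⁻¹ * (2 * (ENNReal.ofReal c *
            (resolventKernel d α ⋆ₗ (resolventKernel d (-(2 * c)) ⋆ₗ F)) p))) := by
            rw [← mul_assoc 2⁻¹, ENNReal.inv_mul_cancel (by simp) (by simp), one_mul,
              mul_left_comm]
        _ ≤ _ := by
            rw [pow_succ, mul_assoc]
            gcongr
  have hlim : Filter.Tendsto (fun n : ℕ => (2⁻¹ : ℝ≥0∞) ^ n *
      (resolventKernel d (-(2 * c)) ⋆ₗ F) p) Filter.atTop (nhds (0 * _)) :=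
    ENNReal.Tendsto.mul_const (ENNReal.tendsto_pow_atTop_nhds_zero_of_lt_one (by simp))
      (.inr (lconvolution_resolventKernel_lt_top (by linarith) hF hF0 (hfin p hp)).ne)
  rw [zero_mul] at hlim
  exact le_antisymm (ge_of_tendsto' hlim fun n => key n p hp) zero_le

/-! ### The maximum principle. -/

/-- The part of the source at points strictly below the barrier that is not absorbed by `α`
times the distance to the barrier. -/
noncomputable def excessSource (gp a c : ℝ × Space d → ℝ≥0∞) (α : ℝ≥0∞) :
    ℝ × Space d → ℝ≥0∞ :=
  {q | a q < c q}.indicator fun q => gp q - α * (c q - a q)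

lemma measurable_excessSource {gp a c : ℝ × Space d → ℝ≥0∞} (hg : Measurable gp)
    (ha : Measurable a) (hc : Measurable c) (α : ℝ≥0∞) : Measurable (excessSource gp a c α) :=
  Measurable.indicator (by fun_prop) (measurableSet_lt ha hc)

lemma excessSource_le (gp a c : ℝ × Space d → ℝ≥0∞) (α : ℝ≥0∞) (q : ℝ × Space d) :
    excessSource gp a c α q ≤ gp q := by
  unfold excessSource
  by_cases h : a q < c q
  · rw [indicator_of_mem (by exact h)]; exact tsub_le_self
  · rw [indicator_of_notMem (by exact h)]; exact zero_le

/-- Strictly below the barrier the gap is positive, so a large multiple of it absorbs the finite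
source: the sequence is eventually zero. -/
lemma tendsto_excessSource {gp a c : ℝ × Space d → ℝ≥0∞} {q : ℝ × Space d} (hg : gp q < ∞) :
    Filter.Tendsto (fun n : ℕ => excessSource gp a c n q) Filter.atTop (nhds 0) := by
  unfold excessSource
  by_cases h : a q < c q
  · simp_rw [indicator_of_mem (s := {q | a q < c q}) h]
    have hpos : c q - a q ≠ 0 := (tsub_pos_of_lt h).ne'
    obtain ⟨N, hN⟩ := ENNReal.exists_nat_mul_gt hpos hg.ne
    refine tendsto_const_nhds.congr' (Filter.eventually_atTop.2 ⟨N, fun n hn => ?_⟩)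
    refine (tsub_eq_zero_of_le (hN.le.trans ?_)).symm
    gcongr
  · simp_rw [indicator_of_notMem (s := {q | a q < c q}) h]
    exact tendsto_const_nhds

/-- Pointwise inequality behind the maximum principle. -/
lemma source_add_le {gp gm a b S κ α : ℝ≥0∞}
    (h : a < b + S ∨ gp ≤ gm + κ * (a - (b + S) + 2 * S)) :
    gp + α * a ≤ gm + α * b + (α + 2 * κ) * S + (α + κ) * (a - (b + S)) +
      (if a < b + S then gp - α * (b + S - a) else 0) := by
  split_ifs with hlt
  -- Below the barrier, `α * a` falls short of `α * (b + S)` by exactly the amount of `gp` that is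
  -- absorbed.
  · have h1 : gp ≤ gp - α * (b + S - a) + α * (b + S - a) := le_tsub_add
    have h2 : α * (b + S - a) + α * a = α * b + α * S := by
      rw [← mul_add, tsub_add_cancel_of_le hlt.le, mul_add]
    calc gp + α * a ≤ gp - α * (b + S - a) + α * (b + S - a) + α * a := by gcongr
      _ = α * b + α * S + (gp - α * (b + S - a)) := by rw [add_assoc, h2, add_comm]
      _ ≤ gm + α * b + (α + 2 * κ) * S + (α + κ) * (a - (b + S)) + (gp - α * (b + S - a)) := by
        refine add_le_add_left (le_trans ?_ le_self_add) _
        exact add_le_add le_add_self (mul_le_mul_left le_self_add _)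
  · have hk : a = (b + S) + (a - (b + S)) := (add_tsub_cancel_of_le (not_lt.1 hlt)).symm
    set k := a - (b + S)
    calc gp + α * a ≤ gm + κ * (k + 2 * S) + α * (b + S + k) := by
          rw [← hk]; gcongr; exact h.resolve_left hlt
      _ = gm + α * b + (α + 2 * κ) * S + (α + κ) * k + 0 := by ring

/-- Maximum principle: if the source `gp - gm` of the heat potential `a - b` is controlled wherever
`a - b` exceeds a supersolution `S` of `∂ₜ - ½Δ - 2κ`, then `a - b` never exceeds `S`. -/
theorem heatPotential_le_of_supersolution {κ T : ℝ} (hκ : 0 ≤ κ)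
    {gp gm a b S : ℝ × Space d → ℝ≥0∞}
    (hgp : Measurable gp) (hgm : Measurable gm) (hS : Measurable S)
    (hgp0 : ∀ q, q.1 ≤ 0 → gp q = 0) (hgpfin : ∀ q, gp q < ∞)
    (ha : a = resolventKernel d 0 ⋆ₗ gp) (hb : b = resolventKernel d 0 ⋆ₗ gm)
    (hafin : ∀ p, p.1 ≤ T → a p < ∞)
    (hSsuper : ∀ α : ℝ, 0 ≤ α → ∀ p,
      ENNReal.ofReal (α + 2 * κ) * (resolventKernel d α ⋆ₗ S) p ≤ S p)
    (h : ∀ᵐ q, q.1 < T → a q < b q + S q ∨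
      gp q ≤ gm q + ENNReal.ofReal κ * (a q - (b q + S q) + 2 * S q))
    {p : ℝ × Space d} (hp : p.1 ≤ T) : a p ≤ b p + S p := by
  have ham : Measurable a := by rw [ha]; fun_prop
  have hbm : Measurable b := by rw [hb]; fun_prop
  set k : ℝ × Space d → ℝ≥0∞ := fun q => a q - (b q + S q) with hk
  have hkm : Measurable k := by fun_prop
  set e : ℕ → ℝ × Space d → ℝ≥0∞ := fun n => excessSource gp a (b + S) n with he
  have hem : ∀ n, Measurable (e n) := fun n => measurable_excessSource hgp ham (hbm.add hS) _
  -- The resolvent equation between `0` and `n`: a heat potential `c` of `g` equals `R_n (g + n c)`.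
  have hpot : ∀ {g c : ℝ × Space d → ℝ≥0∞}, Measurable g → c = resolventKernel d 0 ⋆ₗ g →
      ∀ n : ℕ, c = resolventKernel d n ⋆ₗ (g + (n : ℝ≥0∞) • c) := fun {g c} hg hc n => by
    have hcm : Measurable c := by rw [hc]; fun_prop
    rw [lconvolution_add_right (by fun_prop) hg,
      lconvolution_smul_right _ (by fun_prop) hcm]
    have := resolvent_eq (Nat.cast_nonneg (α := ℝ) n) hg
    rwa [sub_zero, ENNReal.ofReal_natCast, ← hc] at this
  -- Apply `R_n` to `source_add_le`: the terms in `gm` and `b` recombine to `b`, and `(n + 2κ) R_n S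
  -- ≤ S` since `S` is a supersolution.
  have hkle : ∀ n : ℕ, ∀ p : ℝ × Space d, p.1 ≤ T → k p ≤
      ENNReal.ofReal (n + κ) * (resolventKernel d n ⋆ₗ k) p + (resolventKernel d n ⋆ₗ e n) p := by
    intro n p hp
    have hle : a p ≤ (resolventKernel d n ⋆ₗ (((gm + (n : ℝ≥0∞) • b) +
        ENNReal.ofReal (n + 2 * κ) • S) + ENNReal.ofReal (n + κ) • k + e n)) p := by
      conv_lhs => rw [hpot hgp ha n]
      refine lconvolution_resolventKernel_mono ?_ hp
      filter_upwards [h] with q hq hqT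
      have := source_add_le (α := n) (hq hqT)
      simp only [Pi.add_apply, Pi.smul_apply, smul_eq_mul]
      rw [ENNReal.ofReal_add (by positivity) (by positivity),
        ENNReal.ofReal_add (by positivity) (by positivity), ENNReal.ofReal_mul (by norm_num),
        ENNReal.ofReal_natCast, ENNReal.ofReal_ofNat]
      simpa only [he, excessSource, indicator_apply, mem_ofPred_eq, Pi.add_apply] using this
    rw [lconvolution_add_right (by fun_prop) (by fun_prop),
      lconvolution_add_right (by fun_prop) (by fun_prop),
      lconvolution_add_right (by fun_prop) (by fun_prop), ← hpot hgm hb n,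
      lconvolution_smul_right _ (by fun_prop) hS, lconvolution_smul_right _ (by fun_prop) hkm] at hle
    simp only [Pi.add_apply, Pi.smul_apply, smul_eq_mul] at hle
    rw [add_assoc] at hle
    exact tsub_le_iff_left.2 (hle.trans (by gcongr; exact hSsuper n (by positivity) p))
  have hkX : ∀ n : ℕ, 1 ≤ n → ∀ p : ℝ × Space d, p.1 ≤ T →
      k p ≤ (resolventKernel d (-κ) ⋆ₗ e n) p := by
    intro n hn p hp
    -- `X` satisfies with equality the inequality known for `k`, so `(k - X)⁺` satisfies the
    -- homogeneous one and Gronwall applies.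
    set X := resolventKernel d (-κ) ⋆ₗ e n with hX
    have hXm : Measurable X := by have := hem n; fun_prop
    have hn' : (1 : ℝ) ≤ n := by exact_mod_cast hn
    have hXeq := resolvent_eq (α := n) (β := -κ) (by linarith) (hem n)
    rw [sub_neg_eq_add, ← hX] at hXeq
    refine tsub_eq_zero_iff_le.1 (eq_zero_of_le_lconvolution (α := n) (c := n + κ) (T := T)
      (D := fun q => k q - X q) (F := gp) (by positivity) (by positivity) hgp hgp0
      (fun p hp => ha ▸ hafin p hp) ?_ ?_ hp)
    · intro p _
      exact tsub_le_self.trans (tsub_le_self.trans (by rw [ha]))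
    · intro p hp
      have h1 : (resolventKernel d n ⋆ₗ k) p ≤
          (resolventKernel d n ⋆ₗ (fun q => k q - X q)) p + (resolventKernel d n ⋆ₗ X) p := by
        rw [← Pi.add_apply, ← lconvolution_add_right (by fun_prop) (by fun_prop)]
        exact lconvolution_resolventKernel_mono (.of_forall fun q _ => le_tsub_add) hp
      refine tsub_le_iff_right.2 ((hkle n p hp).trans ?_)
      have hXp := congrFun hXeq p
      simp only [Pi.add_apply, Pi.smul_apply, smul_eq_mul] at hXp
      rw [hXp]
      calc _ ≤ ENNReal.ofReal (n + κ) * ((resolventKernel d n ⋆ₗ (fun q => k q - X q)) p +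
            (resolventKernel d n ⋆ₗ X) p) + (resolventKernel d n ⋆ₗ e n) p := by gcongr
        _ = _ := by ring
  -- Dominated convergence: `e n ≤ gp`, and `R_{-κ} gp` is finite at `p`.
  have hlim : Filter.Tendsto (fun n : ℕ => (resolventKernel d (-κ) ⋆ₗ e n) p) Filter.atTop
      (nhds (∫⁻ _ : ℝ × Space d, 0)) := by
    refine tendsto_lintegral_of_dominated_convergence
      (fun y => resolventKernel d (-κ) y * gp (-y + p)) (fun n => ?_) (fun n => ?_) ?_ ?_
    · have := hem n
      fun_prop
    · exact .of_forall fun y => mul_le_mul_right (excessSource_le _ _ _ _ _) _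
    · exact (lconvolution_resolventKernel_lt_top hκ hgp hgp0 (ha ▸ hafin p hp)).ne
    · refine .of_forall fun y => ?_
      have := ENNReal.Tendsto.const_mul (a := resolventKernel d (-κ) y)
        (tendsto_excessSource (a := a) (c := b + S) (hgpfin (-y + p)))
        (.inr (by unfold resolventKernel; rw [indicator_apply]; split_ifs <;> simp))
      rwa [mul_zero] at this
  rw [lintegral_zero] at hlim
  have hk0 : k p = 0 := le_antisymm
    (ge_of_tendsto hlim (Filter.eventually_atTop.2 ⟨1, fun n hn => hkX n hn p hp⟩)) zero_le
  exact tsub_eq_zero_iff_le.1 hk0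

/-! ### Heat flow of the weight `1 + |x|^θ`. -/

lemma rpow_norm_le_factorial_mul_exp {θ y : ℝ} (hθ : 0 < θ) (hy : 0 ≤ y) :
    1 + y ^ θ ≤ (2 + (⌈θ⌉₊.factorial : ℝ)) * Real.exp y := by
  have h1 : 1 ≤ Real.exp y := Real.one_le_exp hy
  have h2 : y ^ θ ≤ 1 + y ^ ⌈θ⌉₊ := by
    rcases le_total y 1 with h | h
    · have := Real.rpow_le_one hy h hθ.le
      have : 0 ≤ y ^ ⌈θ⌉₊ := by positivity
      linarith
    · have := Real.rpow_le_rpow_of_exponent_le h (Nat.le_ceil θ)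
      rw [Real.rpow_natCast] at this
      linarith
  have h3 := Real.pow_div_factorial_le_exp y hy ⌈θ⌉₊
  rw [div_le_iff₀ (by positivity)] at h3
  linarith

lemma one_add_rpow_norm_add_le {E : Type*} [SeminormedAddCommGroup E] {θ : ℝ} (hθ : 0 < θ)
    (x y : E) : 1 + ‖-y + x‖ ^ θ ≤ 2 ^ θ * (1 + ‖x‖ ^ θ) * (1 + ‖y‖ ^ θ) := by
  have h1 : ‖-y + x‖ ≤ 2 * max ‖x‖ ‖y‖ := by
    have := norm_add_le (-y) x
    rw [norm_neg] at this
    linarith [le_max_left ‖x‖ ‖y‖, le_max_right ‖x‖ ‖y‖]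
  have h2 : ‖-y + x‖ ^ θ ≤ 2 ^ θ * (max ‖x‖ ‖y‖) ^ θ := by
    rw [← Real.mul_rpow (by norm_num) (by positivity)]
    exact Real.rpow_le_rpow (norm_nonneg _) h1 hθ.le
  have h3 : (max ‖x‖ ‖y‖) ^ θ ≤ ‖x‖ ^ θ + ‖y‖ ^ θ := by
    have hx : 0 ≤ ‖x‖ ^ θ := by positivity
    have hy : 0 ≤ ‖y‖ ^ θ := by positivity
    rcases max_choice ‖x‖ ‖y‖ with h | h <;> rw [h] <;> linarith
  have h4 : (1 : ℝ) ≤ 2 ^ θ := Real.one_le_rpow (by norm_num) hθ.le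
  have h5 : 0 ≤ ‖x‖ ^ θ * ‖y‖ ^ θ := by positivity
  calc 1 + ‖-y + x‖ ^ θ ≤ 2 ^ θ + 2 ^ θ * (‖x‖ ^ θ + ‖y‖ ^ θ) := by
        exact add_le_add h4 (h2.trans (by gcongr))
    _ = 2 ^ θ * (1 + (‖x‖ ^ θ + ‖y‖ ^ θ)) := by ring
    _ ≤ 2 ^ θ * (1 + (‖x‖ ^ θ + ‖y‖ ^ θ) + ‖x‖ ^ θ * ‖y‖ ^ θ) :=
        mul_le_mul_of_nonneg_left (by linarith) (by positivity)
    _ = _ := by ring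

lemma rpow_norm_le_add {E : Type*} [SeminormedAddCommGroup E] [NormedSpace ℝ E] {θ : ℝ} (hθ : 0 < θ)
    (x y : E) : ‖x‖ ^ θ ≤ ‖-y + x‖ ^ θ + ‖y + x‖ ^ θ := by
  have h1 : ‖x‖ ≤ ‖-y + x‖ ∨ ‖x‖ ≤ ‖y + x‖ := by
    by_contra! h
    have h2 : ‖(2 : ℝ) • x‖ ≤ ‖-y + x‖ + ‖y + x‖ := by
      refine le_trans (le_of_eq ?_) (norm_add_le _ _)
      congr 1; module
    rw [norm_smul, Real.norm_ofNat] at h2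
    linarith
  have ha : 0 ≤ ‖-y + x‖ ^ θ := by positivity
  have hb : 0 ≤ ‖y + x‖ ^ θ := by positivity
  rcases h1 with h | h <;> have := Real.rpow_le_rpow (norm_nonneg x) h hθ.le <;> linarith

/-- Complete the square: the exponents differ by `(2r - ‖y‖)² / (4r)`. The factor `2^(d/2)` compares
the normalisations at times `r` and `2r`. -/
lemma heatKernel_mul_exp_norm_le {r : ℝ} (hr : 0 < r) (y : Space d) :
    heatKernel r y * Real.exp ‖y‖ ≤ 2 ^ ((d : ℝ) / 2) * Real.exp r * heatKernel (2 * r) y := by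
  unfold heatKernel
  have h1 : (2 * Real.pi * r) ^ (-(d : ℝ) / 2) =
      2 ^ ((d : ℝ) / 2) * (2 * Real.pi * (2 * r)) ^ (-(d : ℝ) / 2) := by
    rw [show 2 * Real.pi * (2 * r) = 2 * (2 * Real.pi * r) by ring,
      Real.mul_rpow (x := 2) (by norm_num) (by positivity), ← mul_assoc,
      ← Real.rpow_add (by norm_num)]
    simp [neg_div]
  rw [h1, mul_assoc, ← Real.exp_add, mul_mul_mul_comm (2 ^ ((d : ℝ) / 2)) (Real.exp r),
    ← Real.exp_add]
  refine mul_le_mul_of_nonneg_left (Real.exp_le_exp.2 ?_) (by positivity)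
  have : r + -‖y‖ ^ 2 / (2 * (2 * r)) - (-‖y‖ ^ 2 / (2 * r) + ‖y‖) =
      (2 * r - ‖y‖) ^ 2 / (4 * r) := by field_simp; ring
  have h2 : 0 ≤ (2 * r - ‖y‖) ^ 2 / (4 * r) := by positivity
  linarith

/-- A constant, depending on `θ` and the dimension only, in the upper bound for the heat flow of
the weight `1 + |x|^θ`. -/
noncomputable def weightConst (d : ℕ) (θ : ℝ) : ℝ :=
  2 ^ θ * (2 + (⌈θ⌉₊.factorial : ℝ)) * 2 ^ ((d : ℝ) / 2)

lemma weightConst_pos (d : ℕ) (θ : ℝ) : 0 < weightConst d θ := by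
  unfold weightConst; positivity

lemma lintegral_heatKernel_mul_weight_le {θ r : ℝ} (hθ : 0 < θ) (hr : 0 < r) (x : Space d) :
    ∫⁻ y : Space d, ENNReal.ofReal (heatKernel r y) * ENNReal.ofReal (1 + ‖-y + x‖ ^ θ) ≤
      ENNReal.ofReal (Real.exp r * (weightConst d θ * (1 + ‖x‖ ^ θ))) := by
  have h1 : ∀ y : Space d, ENNReal.ofReal (heatKernel r y) * ENNReal.ofReal (1 + ‖-y + x‖ ^ θ) ≤
      ENNReal.ofReal (Real.exp r * (weightConst d θ * (1 + ‖x‖ ^ θ))) *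
        ENNReal.ofReal (heatKernel (2 * r) y) := fun y => by
    have hw := weightConst_pos d θ
    rw [← ENNReal.ofReal_mul (heatKernel_nonneg hr y), ← ENNReal.ofReal_mul (by positivity)]
    refine ENNReal.ofReal_le_ofReal ?_
    have h2 := heatKernel_nonneg hr y
    calc heatKernel r y * (1 + ‖-y + x‖ ^ θ)
        ≤ heatKernel r y * (2 ^ θ * (1 + ‖x‖ ^ θ) *
          ((2 + (⌈θ⌉₊.factorial : ℝ)) * Real.exp ‖y‖)) := by
          gcongr
          refine (one_add_rpow_norm_add_le hθ x y).trans ?_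
          gcongr
          exact rpow_norm_le_factorial_mul_exp hθ (norm_nonneg y)
      _ = 2 ^ θ * (1 + ‖x‖ ^ θ) * (2 + (⌈θ⌉₊.factorial : ℝ)) *
          (heatKernel r y * Real.exp ‖y‖) := by ring
      _ ≤ 2 ^ θ * (1 + ‖x‖ ^ θ) * (2 + (⌈θ⌉₊.factorial : ℝ)) *
          (2 ^ ((d : ℝ) / 2) * Real.exp r * heatKernel (2 * r) y) := by
          exact mul_le_mul_of_nonneg_left (heatKernel_mul_exp_norm_le hr y) (by positivity)
      _ = _ := by unfold weightConst; ring
  refine (lintegral_mono h1).trans ?_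
  rw [lintegral_const_mul _ (by fun_prop), lintegral_heatKernel (by positivity), mul_one]

/-- The kernel is even, so twice the heat flow averages the sum of the weights at `x - y` and `x +
y`; one of these points has norm at least `‖x‖`. -/
lemma le_lintegral_heatKernel_mul_weight {θ r : ℝ} (hθ : 0 < θ) (hr : 0 < r) (x : Space d) :
    ENNReal.ofReal (1 + ‖x‖ ^ θ) ≤ 2 *
      ∫⁻ y : Space d, ENNReal.ofReal (heatKernel r y) * ENNReal.ofReal (1 + ‖-y + x‖ ^ θ) := by
  have h1 : ∫⁻ y : Space d, ENNReal.ofReal (heatKernel r y) * ENNReal.ofReal (1 + ‖-y + x‖ ^ θ) =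
      ∫⁻ y : Space d, ENNReal.ofReal (heatKernel r y) * ENNReal.ofReal (1 + ‖y + x‖ ^ θ) := by
    rw [← lintegral_neg_eq_self]
    simp [heatKernel_neg]
  rw [two_mul]
  nth_rw 2 [h1]
  rw [← lintegral_add_left (by fun_prop)]
  have h2 : ENNReal.ofReal (1 + ‖x‖ ^ θ) = ∫⁻ y : Space d,
      ENNReal.ofReal (heatKernel r y) * ENNReal.ofReal (1 + ‖x‖ ^ θ) := by
    rw [lintegral_mul_const _ (by fun_prop), lintegral_heatKernel hr, one_mul]
  rw [h2]
  refine lintegral_mono fun y => ?_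
  rw [← mul_add, ← ENNReal.ofReal_add (by positivity) (by positivity)]
  exact mul_le_mul_right (ENNReal.ofReal_le_ofReal (by linarith [rpow_norm_le_add hθ x y])) _

lemma lintegral_Ioi_exp_neg_mul {c : ℝ} (hc : 0 < c) :
    ∫⁻ r in Ioi (0 : ℝ), ENNReal.ofReal (Real.exp (-c * r)) = ENNReal.ofReal c⁻¹ := by
  rw [← ofReal_integral_eq_lintegral_ofReal (integrableOn_exp_mul_Ioi (by linarith) 0)
    (.of_forall fun r => (Real.exp_pos _).le), integral_exp_mul_Ioi (by linarith)]
  congr 1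
  simp

/-! ### The barrier. -/

/-- A supersolution of `∂ₜ - ½Δ - μ` comparable with `e^((μ+2)t) (1 + |x - x₀|^θ)`. -/
noncomputable def barrier (μ θ : ℝ) (x₀ : Space d) : ℝ × Space d → ℝ≥0∞ :=
  resolventKernel d (-μ) ⋆ₗ fun q =>
    ENNReal.ofReal (Real.exp ((μ + 2) * q.1) * (1 + ‖q.2 - x₀‖ ^ θ))

lemma measurable_barrier (μ θ : ℝ) (x₀ : Space d) : Measurable (barrier μ θ x₀) := by
  unfold barrier
  fun_prop

/-- The resolvent equation with the nonnegative term `R_α` of the source dropped. -/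
lemma barrier_supersolution {μ α : ℝ} (hμ : 0 ≤ μ) (hα : 0 ≤ α) (θ : ℝ) (x₀ : Space d)
    (p : ℝ × Space d) :
    ENNReal.ofReal (α + μ) * (resolventKernel d α ⋆ₗ barrier μ θ x₀) p ≤ barrier μ θ x₀ p := by
  have h := congrFun (resolvent_eq (d := d) (α := α) (β := -μ) (by linarith)
    (F := fun q => ENNReal.ofReal (Real.exp ((μ + 2) * q.1) * (1 + ‖q.2 - x₀‖ ^ θ)))
    (by fun_prop)) p
  rw [sub_neg_eq_add] at h
  conv_rhs => rw [barrier, h]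
  exact le_add_self

/-- At time lag `r` the exponentials combine to `e^((μ+2)t) e^(-2r)`. The source extends to all
negative times, so `r` ranges over `(0,∞)`; the decay `e^(-2r)` beats the growth `e^r` in the bound
for the heat flow of the weight. -/
lemma barrier_eq (μ θ : ℝ) (x₀ : Space d) (t : ℝ) (x : Space d) :
    barrier μ θ x₀ (t, x) = ENNReal.ofReal (Real.exp ((μ + 2) * t)) * ∫⁻ r in Ioi (0 : ℝ),
      ENNReal.ofReal (Real.exp (-2 * r)) * ∫⁻ y : Space d,
        ENNReal.ofReal (heatKernel r y) * ENNReal.ofReal (1 + ‖-y + (x - x₀)‖ ^ θ) := by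
  have hm : Measurable fun r : ℝ => ∫⁻ y : Space d,
      ENNReal.ofReal (heatKernel r y) * ENNReal.ofReal (1 + ‖-y + (x - x₀)‖ ^ θ) :=
    Measurable.lintegral_prod_right' (f := fun p : ℝ × Space d =>
      ENNReal.ofReal (heatKernel p.1 p.2) * ENNReal.ofReal (1 + ‖-p.2 + (x - x₀)‖ ^ θ))
      (by fun_prop)
  rw [barrier, lconvolution_def, Measure.volume_eq_prod, lintegral_prod _ (by fun_prop),
    ← lintegral_const_mul _ (by fun_prop), ← lintegral_indicator measurableSet_Ioi]
  refine lintegral_congr fun r => ?_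
  by_cases hr : r ∈ Ioi (0 : ℝ)
  · rw [indicator_of_mem hr, ← lintegral_const_mul _ (by fun_prop),
      ← lintegral_const_mul _ (by fun_prop)]
    refine lintegral_congr fun y => ?_
    rw [resolventKernel_of_pos _ hr, ENNReal.ofReal_mul (Real.exp_pos _).le]
    simp only [Prod.fst_add, Prod.fst_neg, Prod.snd_add, Prod.snd_neg, add_sub_assoc]
    have h2 : ENNReal.ofReal (Real.exp (- -μ * r)) *
        ENNReal.ofReal (Real.exp ((μ + 2) * (-r + t))) =
        ENNReal.ofReal (Real.exp ((μ + 2) * t)) * ENNReal.ofReal (Real.exp (-2 * r)) := by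
      rw [← ENNReal.ofReal_mul (Real.exp_pos _).le, ← ENNReal.ofReal_mul (Real.exp_pos _).le,
        ← Real.exp_add, ← Real.exp_add]
      congr 2; ring
    rw [mul_mul_mul_comm, h2]
    ring
  · rw [indicator_of_notMem hr]
    refine lintegral_eq_zero_of_ae_eq_zero (.of_forall fun y => ?_)
    simp [resolventKernel_of_nonpos (-μ) (p := (r, y)) (not_lt.1 hr)]

lemma barrier_le {θ : ℝ} (hθ : 0 < θ) (μ : ℝ) (x₀ : Space d) (t : ℝ) (x : Space d) :
    barrier μ θ x₀ (t, x) ≤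
      ENNReal.ofReal (Real.exp ((μ + 2) * t) * (weightConst d θ * (1 + ‖x - x₀‖ ^ θ))) := by
  rw [barrier_eq, ENNReal.ofReal_mul (Real.exp_pos _).le]
  gcongr
  calc _ ≤ ∫⁻ r in Ioi (0 : ℝ), ENNReal.ofReal (Real.exp (-1 * r)) *
        ENNReal.ofReal (weightConst d θ * (1 + ‖x - x₀‖ ^ θ)) := by
        refine setLIntegral_mono (by fun_prop) fun r hr => ?_
        refine (mul_le_mul_right (lintegral_heatKernel_mul_weight_le hθ hr _) _).trans ?_
        rw [ENNReal.ofReal_mul (Real.exp_pos _).le, ← mul_assoc,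
          ← ENNReal.ofReal_mul (Real.exp_pos _).le, ← Real.exp_add]
        gcongr
        linarith
    _ = _ := by
        rw [lintegral_mul_const _ (by fun_prop), lintegral_Ioi_exp_neg_mul one_pos]
        simp

/-- The factor `4` is `2 * 2`: the heat flow keeps at least half of the weight, and `e^(-2r)` has
integral `1/2`. -/
lemma le_barrier {θ : ℝ} (hθ : 0 < θ) {μ : ℝ} (hμ : 0 ≤ μ) (x₀ : Space d) {t : ℝ} (ht : 0 ≤ t)
    (x : Space d) : ENNReal.ofReal (1 + ‖x - x₀‖ ^ θ) ≤ 4 * barrier μ θ x₀ (t, x) := by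
  rw [barrier_eq]
  have h1 : 1 ≤ ENNReal.ofReal (Real.exp ((μ + 2) * t)) := by
    rw [ENNReal.one_le_ofReal, Real.one_le_exp_iff]; positivity
  have h2 : ENNReal.ofReal (2 : ℝ)⁻¹ * ENNReal.ofReal (1 + ‖x - x₀‖ ^ θ) ≤
      2 * ∫⁻ r in Ioi (0 : ℝ), ENNReal.ofReal (Real.exp (-2 * r)) * ∫⁻ y : Space d,
        ENNReal.ofReal (heatKernel r y) * ENNReal.ofReal (1 + ‖-y + (x - x₀)‖ ^ θ) := by
    rw [← lintegral_Ioi_exp_neg_mul two_pos, ← lintegral_mul_const _ (by fun_prop),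
      ← lintegral_const_mul' _ _ (by simp)]
    refine lintegral_mono_ae ((ae_restrict_iff' measurableSet_Ioi).2 (.of_forall fun r hr => ?_))
    rw [mul_left_comm]
    gcongr
    exact le_lintegral_heatKernel_mul_weight hθ hr _
  set I := ∫⁻ r in Ioi (0 : ℝ), ENNReal.ofReal (Real.exp (-2 * r)) * ∫⁻ y : Space d,
        ENNReal.ofReal (heatKernel r y) * ENNReal.ofReal (1 + ‖-y + (x - x₀)‖ ^ θ)
  calc ENNReal.ofReal (1 + ‖x - x₀‖ ^ θ)
      = ENNReal.ofReal 2 * (ENNReal.ofReal (2 : ℝ)⁻¹ * ENNReal.ofReal (1 + ‖x - x₀‖ ^ θ)) := by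
        rw [← mul_assoc, ← ENNReal.ofReal_mul (by norm_num)]; simp
    _ ≤ ENNReal.ofReal 2 * (2 * I) := by gcongr
    _ = 4 * (1 * I) := by rw [ENNReal.ofReal_ofNat]; ring
    _ ≤ _ := by gcongr

/-! ### From solutions to heat potentials, and one-sided comparison. -/

/-- Solutions are not assumed measurable; measurability of the source is recovered by dividing the
integrand by the strictly positive kernel. -/
lemma aestronglyMeasurable_of_integrableOn_heatKernel_mul {T : ℝ} {F : ℝ × Space d → ℝ}
    {x : Space d} (h : IntegrableOn (fun p : ℝ × Space d => heatKernel (T - p.1) (x - p.2) * F p)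
      (Ioo 0 T ×ˢ univ)) :
    AEStronglyMeasurable F (volume.restrict (Ioo 0 T ×ˢ univ)) := by
  have hk : AEStronglyMeasurable (fun p : ℝ × Space d => (heatKernel (T - p.1) (x - p.2))⁻¹)
      (volume.restrict (Ioo 0 T ×ˢ univ)) :=
    Measurable.aestronglyMeasurable (by fun_prop)
  refine (hk.mul h.aestronglyMeasurable).congr ?_
  filter_upwards [ae_restrict_mem (measurableSet_Ioo.prod .univ)] with p hp
  have := (heatKernel_pos (sub_pos.2 hp.1.2) (x - p.2)).ne'
  simp only [Pi.mul_apply]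
  field_simp

lemma heatPotential_eq {T t : ℝ} (ht : t ≤ T) (x : Space d) {F : ℝ × Space d → ℝ}
    {g : ℝ × Space d → ℝ≥0∞} (hg0 : ∀ q, q.1 ≤ 0 → g q = 0)
    (hg : ∀ᵐ q, q ∈ Ioo 0 T ×ˢ (univ : Set (Space d)) → g q = ENNReal.ofReal (F q)) :
    (resolventKernel d 0 ⋆ₗ g) (t, x) = ∫⁻ p in Ioo 0 t ×ˢ univ,
      ENNReal.ofReal (heatKernel (t - p.1) (x - p.2) * F p) := by
  rw [lconvolution_comm, lconvolution_def,
    ← lintegral_indicator (measurableSet_Ioo.prod .univ)]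
  refine lintegral_congr_ae ?_
  filter_upwards [hg] with q hq
  by_cases hqt : q ∈ Ioo 0 t ×ˢ (univ : Set (Space d))
  · rw [indicator_of_mem hqt, hq ⟨⟨hqt.1.1, hqt.1.2.trans_le ht⟩, mem_univ _⟩,
      show -q + (t, x) = (t - q.1, x - q.2) by rw [neg_add_eq_sub]; rfl,
      resolventKernel_of_pos _ (sub_pos.2 hqt.1.2),
      ENNReal.ofReal_mul (heatKernel_nonneg (sub_pos.2 hqt.1.2) _), mul_comm]
    simp
  · rw [indicator_of_notMem hqt]
    rcases le_or_gt q.1 0 with h0 | h0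
    · rw [hg0 q h0, zero_mul]
    · have h1 : t ≤ q.1 := not_lt.1 fun h => hqt ⟨⟨h0, h⟩, mem_univ _⟩
      rw [resolventKernel_of_nonpos _ (by simpa using h1), mul_zero]

lemma intervalIntegral_heatKernel_mul {t : ℝ} (ht : 0 ≤ t) (x : Space d) {F : ℝ × Space d → ℝ}
    (h : IntegrableOn (fun p : ℝ × Space d => heatKernel (t - p.1) (x - p.2) * F p)
      (Ioo 0 t ×ˢ univ)) :
    ∫ s in (0 : ℝ)..t, ∫ y, heatKernel (t - s) (x - y) * F (s, y) =
      ∫ p in Ioo 0 t ×ˢ univ, heatKernel (t - p.1) (x - p.2) * F p := by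
  rw [Measure.volume_eq_prod] at h ⊢
  rw [intervalIntegral.integral_of_le ht, integral_Ioc_eq_integral_Ioo, setIntegral_prod _ h]
  simp

/-- One-sided comparison of two solutions. -/
theorem IsSolution.sub_le {κ : ℝ} {f : ℝ → ℝ} (hf : IsDrift κ f) {T : ℝ} (hT : 0 < T)
    {z₁ z₂ u₁ u₂ : ℝ → Space d → ℝ} (h₁ : IsSolution f T z₁ u₁) (h₂ : IsSolution f T z₂ u₂)
    {θ : ℝ} (hθ : 0 < θ) (x₀ : Space d) {N : ℝ} (hN : 0 ≤ N)
    (hz : ∀ t ∈ Icc 0 T, ∀ x, |z₁ t x - z₂ t x| ≤ N * (1 + ‖x - x₀‖ ^ θ))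
    {t : ℝ} (ht : t ∈ Icc 0 T) (x : Space d) :
    u₁ t x - u₂ t x ≤ (z₁ t x - z₂ t x) + 4 * N *
      (Real.exp ((2 * max κ 0 + 2) * t) * (weightConst d θ * (1 + ‖x - x₀‖ ^ θ))) := by
  set κ' := max κ 0 with hκ'
  have hκ0 : 0 ≤ κ' := le_max_right _ _
  set F : ℝ × Space d → ℝ := fun p => f (u₁ p.1 p.2) - f (u₂ p.1 p.2) with hF
  have hint : ∀ t ∈ Icc 0 T, ∀ x : Space d, IntegrableOn
      (fun p : ℝ × Space d => heatKernel (t - p.1) (x - p.2) * F p) (Ioo 0 t ×ˢ univ) := by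
    intro t ht x
    refine ((h₁ t ht x).1.sub (h₂ t ht x).1).congr (.of_forall fun p => ?_)
    simp only [Pi.sub_apply, hF, mul_sub]
  have hsub : ∀ t ∈ Icc 0 T, ∀ x : Space d, u₁ t x - u₂ t x =
      (∫ p in Ioo 0 t ×ˢ univ, heatKernel (t - p.1) (x - p.2) * F p) + (z₁ t x - z₂ t x) := by
    intro t ht x
    have e1 := intervalIntegral_heatKernel_mul ht.1 x (F := fun p => f (u₁ p.1 p.2)) (h₁ t ht x).1
    have e2 := intervalIntegral_heatKernel_mul ht.1 x (F := fun p => f (u₂ p.1 p.2)) (h₂ t ht x).1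
    rw [(h₁ t ht x).2, (h₂ t ht x).2, e1, e2]
    simp only [hF, mul_sub]
    rw [integral_sub (h₁ t ht x).1 (h₂ t ht x).1]
    ring
  have hFm := aestronglyMeasurable_of_integrableOn_heatKernel_mul (hint T ⟨hT.le, le_rfl⟩ 0)
  obtain ⟨g, hgm, hFg⟩ := hFm
  rw [Filter.EventuallyEq, ae_restrict_iff' (measurableSet_Ioo.prod .univ)] at hFg
  set Q : Set (ℝ × Space d) := Ioo 0 T ×ˢ univ with hQ
  have hQm : MeasurableSet Q := measurableSet_Ioo.prod .univ
  have hQ0 : ∀ q : ℝ × Space d, q.1 ≤ 0 → q ∉ Q := fun q hq h => not_lt.2 hq h.1.1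
  set gp : ℝ × Space d → ℝ≥0∞ := Q.indicator fun q => ENNReal.ofReal (g q) with hgp
  set gm : ℝ × Space d → ℝ≥0∞ := Q.indicator fun q => ENNReal.ofReal (-g q) with hgmdef
  have hgpm : Measurable gp := hgm.measurable.ennreal_ofReal.indicator hQm
  have hgmm : Measurable gm := hgm.measurable.neg.ennreal_ofReal.indicator hQm
  set a := resolventKernel d 0 ⋆ₗ gp with ha
  set b := resolventKernel d 0 ⋆ₗ gm with hb
  have haeq : ∀ t ≤ T, ∀ x, a (t, x) = ∫⁻ p in Ioo 0 t ×ˢ univ,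
      ENNReal.ofReal (heatKernel (t - p.1) (x - p.2) * F p) := fun t ht x =>
    heatPotential_eq ht x (fun q hq => indicator_of_notMem (hQ0 q hq) _) (by
      filter_upwards [hFg] with q hq hqQ
      rw [hgp, indicator_of_mem hqQ, hq hqQ])
  have hbeq : ∀ t ≤ T, ∀ x, b (t, x) = ∫⁻ p in Ioo 0 t ×ˢ univ,
      ENNReal.ofReal (-(heatKernel (t - p.1) (x - p.2) * F p)) := fun t ht x => by
    simp_rw [← mul_neg]
    exact heatPotential_eq (F := fun p => -F p) ht x
      (fun q hq => indicator_of_notMem (hQ0 q hq) _) (by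
        filter_upwards [hFg] with q hq hqQ
        rw [hgmdef, indicator_of_mem hqQ, hq hqQ])
  -- The maximum principle runs over all times up to `T`, negative ones included.
  have hneg : ∀ t ≤ 0, ∀ x, a (t, x) = 0 ∧ b (t, x) = 0 := fun t ht x => by
    rw [haeq t (ht.trans hT.le), hbeq t (ht.trans hT.le), Ioo_eq_empty (not_lt.2 ht)]
    simp
  have hafin : ∀ p, p.1 ≤ T → a p < ∞ := by
    rintro ⟨t, x⟩ ht
    rcases le_or_gt t 0 with h0 | h0
    · rw [(hneg t h0 x).1]; exact ENNReal.zero_lt_top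
    · rw [haeq t ht]; exact (hint t ⟨h0.le, ht⟩ x).lintegral_lt_top
  have hbfin : ∀ p, p.1 ≤ T → b p < ∞ := by
    rintro ⟨t, x⟩ ht
    rcases le_or_gt t 0 with h0 | h0
    · rw [(hneg t h0 x).2]; exact ENNReal.zero_lt_top
    · rw [hbeq t ht]; exact (hint t ⟨h0.le, ht⟩ x).neg.lintegral_lt_top
  have hab : ∀ t ∈ Icc 0 T, ∀ x : Space d, u₁ t x - u₂ t x =
      (a (t, x)).toReal - (b (t, x)).toReal + (z₁ t x - z₂ t x) := fun t ht x => by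
    rw [hsub t ht x, integral_eq_lintegral_pos_part_sub_lintegral_neg_part (hint t ht x),
      haeq t ht.2, hbeq t ht.2]
  -- The factor `4 * N` makes `S` dominate `|z₁ - z₂|`, by `le_barrier`.
  set S : ℝ × Space d → ℝ≥0∞ := ENNReal.ofReal (4 * N) • barrier (2 * κ') θ x₀ with hS
  have hSm : Measurable S := (measurable_barrier _ _ _).const_smul _
  have hSle : ∀ (t : ℝ) (x : Space d), S (t, x) ≤ ENNReal.ofReal (4 * N *
      (Real.exp ((2 * κ' + 2) * t) * (weightConst d θ * (1 + ‖x - x₀‖ ^ θ)))) := fun t x => by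
    rw [ENNReal.ofReal_mul (by positivity)]
    exact mul_le_mul_right (barrier_le hθ _ _ _ _) _
  have hSfin : ∀ p, S p ≠ ∞ := fun p => ((hSle p.1 p.2).trans_lt ENNReal.ofReal_lt_top).ne
  have hSz : ∀ t ∈ Icc 0 T, ∀ x : Space d, |z₁ t x - z₂ t x| ≤ (S (t, x)).toReal := by
    intro t ht x
    rw [← ENNReal.ofReal_le_iff_le_toReal (hSfin _)]
    refine (ENNReal.ofReal_le_ofReal (hz t ht x)).trans ?_
    rw [ENNReal.ofReal_mul hN]
    refine (mul_le_mul_right (le_barrier hθ (μ := 2 * κ') (by positivity) x₀ ht.1 x) _).trans ?_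
    rw [hS, Pi.smul_apply, smul_eq_mul, mul_comm 4 N, ENNReal.ofReal_mul hN, mul_assoc,
      ENNReal.ofReal_ofNat]
  have hsuper : ∀ α : ℝ, 0 ≤ α → ∀ p,
      ENNReal.ofReal (α + 2 * κ') * (resolventKernel d α ⋆ₗ S) p ≤ S p := by
    intro α hα p
    rw [hS, lconvolution_smul_right _ (by fun_prop) (measurable_barrier _ _ _), Pi.smul_apply,
      Pi.smul_apply, smul_eq_mul, smul_eq_mul, mul_left_comm]
    exact mul_le_mul_right (barrier_supersolution (by positivity) hα _ _ _) _
  have hsource : ∀ᵐ q : ℝ × Space d, q.1 < T → a q < b q + S q ∨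
      gp q ≤ gm q + ENNReal.ofReal κ' * (a q - (b q + S q) + 2 * S q) := by
    filter_upwards [hFg] with q hq hqT
    refine or_iff_not_imp_left.2 fun hlt => ?_
    rcases le_or_gt q.1 0 with h0 | h0
    · rw [hgp, indicator_of_notMem (hQ0 q h0)]; exact zero_le
    have hqQ : q ∈ Q := ⟨⟨h0, hqT⟩, mem_univ _⟩
    have hqI : q.1 ∈ Icc 0 T := ⟨h0.le, hqT.le⟩
    have hafq := (hafin q hqT.le).ne
    have hbfq := (hbfin q hqT.le).ne
    have hge : (b q).toReal + (S q).toReal ≤ (a q).toReal := by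
      rw [← ENNReal.toReal_add hbfq (hSfin q)]
      exact ENNReal.toReal_mono hafq (not_lt.1 hlt)
    have hw := hab q.1 hqI q.2
    have hζ := abs_le.1 (hSz q.1 hqI q.2)
    rw [Prod.mk.eta] at hw hζ
    have hS0 : 0 ≤ (S q).toReal := ENNReal.toReal_nonneg
    -- Here `a - b ≥ S ≥ |z₁ - z₂|`, hence `0 ≤ u₁ - u₂ ≤ a - b + S`. The sign allows replacing `κ`
    -- by `κ'`; equality is separate because the drift condition compares distinct points.
    have hFle : F q ≤ κ' * ((a q).toReal - (b q).toReal + (S q).toReal) := by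
      rcases eq_or_lt_of_le (show u₂ q.1 q.2 ≤ u₁ q.1 q.2 by linarith) with h | h
      · rw [hF]
        simp only [h, sub_self]
        exact mul_nonneg hκ0 (by linarith)
      · calc F q ≤ κ * (u₁ q.1 q.2 - u₂ q.1 q.2) := hf.oneSidedLipschitz _ _ h
          _ ≤ κ' * (u₁ q.1 q.2 - u₂ q.1 q.2) :=
            mul_le_mul_of_nonneg_right (le_max_left _ _) (by linarith)
          _ ≤ _ := mul_le_mul_of_nonneg_left (by linarith) hκ0
    refine le_trans ?_ le_add_self
    rw [hgp, indicator_of_mem hqQ, ← hq hqQ]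
    refine (ENNReal.ofReal_le_ofReal hFle).trans ?_
    rw [ENNReal.ofReal_mul hκ0]
    refine mul_le_mul_right (le_of_eq ?_) _
    rw [show (a q).toReal - (b q).toReal + (S q).toReal =
        ((a q).toReal - ((b q).toReal + (S q).toReal)) + 2 * (S q).toReal by ring,
      ENNReal.ofReal_add (by linarith) (by linarith), ENNReal.ofReal_sub _ (by positivity),
      ENNReal.ofReal_add (by positivity) (by positivity), ENNReal.ofReal_mul (by norm_num),
      ENNReal.ofReal_toReal hafq, ENNReal.ofReal_toReal hbfq, ENNReal.ofReal_toReal (hSfin q),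
      ENNReal.ofReal_ofNat]
  have hmax := heatPotential_le_of_supersolution hκ0 hgpm hgmm hSm
    (fun q hq => indicator_of_notMem (hQ0 q hq) _)
    (fun q => by rw [hgp, indicator_apply]; split_ifs <;> simp) ha hb hafin hsuper hsource
    (p := (t, x)) ht.2
  have hreal : (a (t, x)).toReal ≤ (b (t, x)).toReal + (S (t, x)).toReal := by
    have hbf := (hbfin (t, x) ht.2).ne
    rw [← ENNReal.toReal_add hbf (hSfin _)]
    exact ENNReal.toReal_mono (ENNReal.add_ne_top.2 ⟨hbf, hSfin _⟩) hmax
  have hw := weightConst_pos d θ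
  have hSr := ENNReal.toReal_le_of_le_ofReal (by positivity) (hSle t x)
  have := hab t ht x
  linarith

/-! ### Weighted norms and the conclusion. -/

lemma abs_le_of_weightedNorm_ne_top {T θ : ℝ} {x₀ : Space d} {ψ : ℝ → Space d → ℝ}
    (h : weightedNorm T θ x₀ ψ ≠ ∞) {t : ℝ} (ht : t ∈ Icc 0 T) (x : Space d) :
    |ψ t x| ≤ (weightedNorm T θ x₀ ψ).toReal * (1 + ‖x - x₀‖ ^ θ) := by
  rw [← div_le_iff₀ (by positivity), ← ENNReal.ofReal_le_iff_le_toReal h]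
  exact le_iSup₂_of_le t ht (le_iSup_of_le x le_rfl)

lemma weightedNorm_le_ofReal {T θ M : ℝ} {x₀ : Space d} {ψ : ℝ → Space d → ℝ}
    (h : ∀ t ∈ Icc 0 T, ∀ x, |ψ t x| ≤ M * (1 + ‖x - x₀‖ ^ θ)) :
    weightedNorm T θ x₀ ψ ≤ ENNReal.ofReal M :=
  iSup₂_le fun t ht => iSup_le fun x => ENNReal.ofReal_le_ofReal <|
    (div_le_iff₀ (by positivity)).2 (h t ht x)

/-- A constant for the Lipschitz estimate. -/
noncomputable def lipschitzConst (d : ℕ) (κ θ : ℝ) : ℝ :=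
  -- One number serves as both prefactor and exponential rate, so it is the sum of the two
  -- requirements.
  1 + 4 * weightConst d θ + (2 * max κ 0 + 2)

lemma lipschitzConst_pos (d : ℕ) (κ θ : ℝ) : 0 < lipschitzConst d κ θ := by
  have h1 := weightConst_pos d θ
  have h2 : 0 ≤ max κ 0 := le_max_right _ _
  unfold lipschitzConst
  positivity

theorem IsSolution.abs_sub_le {κ : ℝ} {f : ℝ → ℝ} (hf : IsDrift κ f) {T : ℝ} (hT : 0 < T)
    {z₁ z₂ u₁ u₂ : ℝ → Space d → ℝ} (h₁ : IsSolution f T z₁ u₁) (h₂ : IsSolution f T z₂ u₂)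
    {θ : ℝ} (hθ : 0 < θ) (x₀ : Space d) {N : ℝ} (hN : 0 ≤ N)
    (hz : ∀ t ∈ Icc 0 T, ∀ x, |z₁ t x - z₂ t x| ≤ N * (1 + ‖x - x₀‖ ^ θ))
    {t : ℝ} (ht : t ∈ Icc 0 T) (x : Space d) :
    |u₁ t x - u₂ t x| ≤ lipschitzConst d κ θ * Real.exp (lipschitzConst d κ θ * T) * N *
      (1 + ‖x - x₀‖ ^ θ) := by
  have hw := weightConst_pos d θ
  have hκ : 0 ≤ max κ 0 := le_max_right _ _
  have hC := lipschitzConst_pos d κ θ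
  have e1 := h₁.sub_le hf hT h₂ hθ x₀ hN hz ht x
  have e2 := h₂.sub_le hf hT h₁ hθ x₀ hN (fun t ht x => by rw [abs_sub_comm]; exact hz t ht x) ht x
  have hζ := abs_le.1 (hz t ht x)
  have hρ : 0 ≤ N * (1 + ‖x - x₀‖ ^ θ) := by positivity
  have hexp : Real.exp ((2 * max κ 0 + 2) * t) ≤ Real.exp (lipschitzConst d κ θ * T) := by
    refine Real.exp_le_exp.2 (mul_le_mul ?_ ht.2 ht.1 hC.le)
    unfold lipschitzConst
    linarith
  have hone : 1 ≤ Real.exp (lipschitzConst d κ θ * T) := Real.one_le_exp (by positivity)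
  have hbound : N * (1 + ‖x - x₀‖ ^ θ) + 4 * N *
      (Real.exp ((2 * max κ 0 + 2) * t) * (weightConst d θ * (1 + ‖x - x₀‖ ^ θ))) ≤
      lipschitzConst d κ θ * Real.exp (lipschitzConst d κ θ * T) * N * (1 + ‖x - x₀‖ ^ θ) := by
    calc _ = (1 + 4 * weightConst d θ * Real.exp ((2 * max κ 0 + 2) * t)) *
          (N * (1 + ‖x - x₀‖ ^ θ)) := by ring
      _ ≤ (1 * Real.exp (lipschitzConst d κ θ * T) +
          4 * weightConst d θ * Real.exp (lipschitzConst d κ θ * T)) *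
          (N * (1 + ‖x - x₀‖ ^ θ)) := by
          refine mul_le_mul_of_nonneg_right (add_le_add (by linarith) ?_) hρ
          exact mul_le_mul_of_nonneg_left hexp (by positivity)
      _ = (1 + 4 * weightConst d θ) * (Real.exp (lipschitzConst d κ θ * T) *
          (N * (1 + ‖x - x₀‖ ^ θ))) := by ring
      _ ≤ lipschitzConst d κ θ * (Real.exp (lipschitzConst d κ θ * T) *
          (N * (1 + ‖x - x₀‖ ^ θ))) := by
          refine mul_le_mul_of_nonneg_right ?_ (by positivity)
          unfold lipschitzConst
          linarith
      _ = _ := by ring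
  rw [abs_le]
  constructor <;> linarith

theorem mainTheorem5 (d : ℕ) (κ : ℝ) :
    (∀ θ : ℝ, 0 < θ → ∃ C : ℝ, 0 < C ∧
      ∀ f : ℝ → ℝ, IsDrift κ f → ∀ T : ℝ, 0 < T →
      ∀ z₁ z₂ : ℝ → Space d → ℝ, IsBoundedContinuous T z₁ → IsBoundedContinuous T z₂ →
      ∀ u₁ u₂ : ℝ → Space d → ℝ, IsSolution f T z₁ u₁ → IsSolution f T z₂ u₂ →
      ∀ x₀ : Space d,
        weightedNorm T θ x₀ (fun t x => u₁ t x - u₂ t x) ≤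
          ENNReal.ofReal (C * Real.exp (C * T)) *
            weightedNorm T θ x₀ (fun t x => z₁ t x - z₂ t x)) ∧
    (∀ f : ℝ → ℝ, IsDrift κ f → ∀ T : ℝ, 0 < T →
      ∀ z : ℝ → Space d → ℝ, IsBoundedContinuous T z →
      ∀ u₁ u₂ : ℝ → Space d → ℝ, IsSolution f T z u₁ → IsSolution f T z u₂ →
      ∀ t ∈ Icc 0 T, ∀ x : Space d, u₁ t x = u₂ t x) := by
  refine ⟨fun θ hθ => ⟨lipschitzConst d κ θ, lipschitzConst_pos d κ θ, ?_⟩, ?_⟩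
  · intro f hf T hT z₁ z₂ _ _ u₁ u₂ h₁ h₂ x₀
    have hC := lipschitzConst_pos d κ θ
    by_cases htop : weightedNorm T θ x₀ (fun t x => z₁ t x - z₂ t x) = ∞
    · rw [htop, ENNReal.mul_top (by simpa using by positivity)]
      exact le_top
    rw [← ENNReal.ofReal_toReal htop, ← ENNReal.ofReal_mul (by positivity)]
    exact weightedNorm_le_ofReal fun t ht x => h₁.abs_sub_le hf hT h₂ hθ x₀
      ENNReal.toReal_nonneg (fun t ht x => abs_le_of_weightedNorm_ne_top htop ht x) ht x
  · intro f hf T hT z _ u₁ u₂ h₁ h₂ t ht x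
    -- Uniqueness is the estimate with `N = 0`; the weight `θ = 1`, `x₀ = 0` is an arbitrary choice.
    have := h₁.abs_sub_le hf hT h₂ one_pos 0 le_rfl (fun t _ x => by simp) ht x
    rw [mul_zero, zero_mul] at this
    exact sub_eq_zero.1 (abs_nonpos_iff.1 this)
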